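/- Let $V$ be a finite-dimensional real vector space, $V_{\mathbb C}$ its complexification, $\rho:V_{\mathbb C}\oplus V_{\mathbb C}^*\to V_{\mathbb C}$ and $\rho^*:V_{\mathbb C}\oplus V_{\mathbb C}^*\to V_{\mathbb C}^*$ the projections, and equip $V_{\mathbb C}\oplus V_{\mathbb C}^*$ with the pairing $\langle v+f,w+g\rangle=-\tfrac12(f(w)+g(v))$. Let $E\subset V_{\mathbb C}\oplus V_{\mathbb C}^*$ be a generalized complex (GC) structure on $V$, i.e. a maximally isotropic subspace (isotropic with $\dim_{\mathbb C}E=\dim_{\mathbb R}V$) such that $E\cap\overline E=0$. A spinor $\phi\in\bigwedge^\bullet V_{\mathbb C}^*$ is pure if $\phi\ne0$ and its annihilator under the action $(v+f)\cdot\phi=\iota_v\phi+f\wedge\phi$ of $V_{\mathbb C}\oplus V_{\mathbb C}^*$ is maximally isotropic; it is then called a representative spinor for that annihilator. Let $W\subseteq V$ be any real subspace with inclusion $j:W\hookrightarrow V$, let $$E_W=\{(\rho(e),\rho^*(e)|_{W_{\mathbb C}}) : e\in E\cap(W_{\mathbb C}\oplus V_{\mathbb C}^*)\}\subseteq W_{\mathbb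 C}\oplus W_{\mathbb C}^*,$$ and call $W$ a GC subspace of $V$ if $E_W\cap\overline{E_W}=0$. For $\phi,\psi\in\bigwedge^\bullet W_{\mathbb C}^*$ let the Mukai pairing $\langle\phi,\psi\rangle_M\in\bigwedge^{\dim W}W_{\mathbb C}^*$ be the top-degree component of $\sigma(\phi)\wedge\psi$, where $\sigma$ is the anti-automorphism equal to $(-1)^{p(p-1)/2}$ in degree $p$. Then there are integers $0\le l\le k$, a two-form $u\in\bigwedge^2V_{\mathbb C}^*$ and $f_1,\dots,f_k\in V_{\mathbb C}^*$ such that (i) $\phi=\exp(u)\wedge f_1\wedge\dots\wedge f_k$ is a representative spinor for $E$; (ii) $j^*f_1,\dots,j^*f_l$ form a basis of $\operatorname{Ann}(\rho(E)\cap W_{\mathbb C})\subseteq W_{\mathbb C}^*$; (iii) $f_{l+1},\dots,f_k$ form a basis of $\operatorname{Ann}(\rho(E)+W_{\mathbb C})\subseteq V_{\mathbb C}^*$. Moreover, for any $k,l,u,f_1,\dots,f_k$ with these properties, $\phi_W:=\exp(j^*u)\wedge j^*f_1\wedge\dots\wedge j^*f_l$ is a representative spinor for $E_W$, and $W$ is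 a GC subspace of $V$ if and only if $\langle\phi_W,\overline{\phi_W}\rangle_M\neq0$. -/

import Mathlib

open scoped TensorProduct

namespace GCLin

noncomputable section

/-! ## Complexification and complex conjugation -/

/-- The complexification `V_ℂ = ℂ ⊗ V` of a real vector space. -/
abbrev Cx (V : Type*) [AddCommGroup V] [Module ℝ V] : Type _ := ℂ ⊗[ℝ] V

/-- The complex dual `V_ℂ^*` of the complexification. -/
abbrev CxDual (V : Type*) [AddCommGroup V] [Module ℝ V] : Type _ := Module.Dual ℂ (Cx V)

/-- The space of spinors `S(V) = ⋀ V_ℂ^*`. -/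
abbrev Spinor (V : Type*) [AddCommGroup V] [Module ℝ V] : Type _ := ExteriorAlgebra ℂ (CxDual V)

section

variable {V : Type*} [AddCommGroup V] [Module ℝ V]

/-- Complex conjugation on `V_ℂ`: `z ⊗ v ↦ z̄ ⊗ v`. -/
def conjV : Cx V →ₛₗ[starRingEnd ℂ] Cx V where
  toFun := LinearMap.rTensor V Complex.conjAe.toLinearMap
  map_add' := map_add _
  map_smul' c x := by
    induction x using TensorProduct.induction_on with
    | zero => simp
    | tmul z v => simp [TensorProduct.smul_tmul']
    | add x y hx hy => rw [smul_add, map_add, hx, hy, map_add, smul_add]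

@[simp]
theorem conjV_tmul (z : ℂ) (v : V) :
    conjV (z ⊗ₜ[ℝ] v : Cx V) = (starRingEnd ℂ z) ⊗ₜ[ℝ] v := rfl

@[simp]
theorem conjV_conjV (x : Cx V) : conjV (conjV x) = x := by
  induction x using TensorProduct.induction_on with
  | zero => simp
  | tmul z v => simp
  | add x y hx hy => rw [map_add, map_add, hx, hy]

/-- Complex conjugation on `V_ℂ^* = (V^*)_ℂ`: `f̄(x)` is the conjugate of `f(x̄)`. -/
def conjDual : CxDual V →ₛₗ[starRingEnd ℂ] CxDual V where
  toFun f :=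
    { toFun := fun x => starRingEnd ℂ (f (conjV x))
      map_add' := fun x y => by simp
      map_smul' := fun c x => by simp }
  map_add' f g := by ext; simp
  map_smul' c f := by ext; simp

@[simp]
theorem conjDual_apply (f : CxDual V) (x : Cx V) :
    conjDual f x = starRingEnd ℂ (f (conjV x)) := rfl

/-- Complex conjugation on `V_ℂ ⊕ V_ℂ^*`. -/
def conjDouble : (Cx V × CxDual V) →ₛₗ[starRingEnd ℂ] (Cx V × CxDual V) where
  toFun e := (conjV e.1, conjDual e.2)
  map_add' x y := by simp
  map_smul' c x := by simp

/-- The conjugate `Ē` of a complex subspace `E` of `V_ℂ ⊕ V_ℂ^*`. -/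
def conjSubspace (E : Submodule ℂ (Cx V × CxDual V)) : Submodule ℂ (Cx V × CxDual V) :=
  E.map conjDouble

variable (V) in
/-- The `ℂ`-algebra structure on the spinors whose scalar multiplication is precomposed with
complex conjugation of `ℂ`. -/
abbrev twistedAlgebra : Algebra ℂ (Spinor V) := Algebra.compHom (Spinor V) (starRingEnd ℂ)

/-- Complex conjugation on the spinors: the ring homomorphism of `⋀ V_ℂ^*` that is
conjugate-linear over `ℂ` and restricts to `conjDual` on `V_ℂ^*`
(see `conjSpinor_ι` and `conjSpinor_smul`).
It is obtained from the universal property of the exterior algebra, with `twistedAlgebra` as the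
algebra structure of the target. -/
def conjSpinor : Spinor V →+* Spinor V :=
  RingHomClass.toRingHom
    (@ExteriorAlgebra.lift ℂ _ (CxDual V) _ _ (Spinor V) _ (twistedAlgebra V)
      ⟨@LinearMap.mk ℂ ℂ _ _ (RingHom.id ℂ) (CxDual V) (Spinor V) _ _ _ (twistedAlgebra V).toModule
        ⟨fun f => ExteriorAlgebra.ι ℂ (conjDual f), fun f g => by simp⟩
        (fun c f => by
          change ExteriorAlgebra.ι ℂ (conjDual (c • f)) =
            (starRingEnd ℂ c) • ExteriorAlgebra.ι ℂ (conjDual f)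
          simp),
        fun f => ExteriorAlgebra.ι_sq_zero (conjDual f)⟩)

@[simp]
theorem conjSpinor_ι (f : CxDual V) :
    conjSpinor (ExteriorAlgebra.ι ℂ f) = ExteriorAlgebra.ι ℂ (conjDual f) :=
  @ExteriorAlgebra.lift_ι_apply ℂ _ (CxDual V) _ _ (Spinor V) _ (twistedAlgebra V) _ _ f

theorem conjSpinor_algebraMap (c : ℂ) :
    conjSpinor (algebraMap ℂ (Spinor V) c) = algebraMap ℂ (Spinor V) (starRingEnd ℂ c) :=
  @AlgHom.commutes ℂ (Spinor V) (Spinor V) _ _ _ _ (twistedAlgebra V)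
    (@ExteriorAlgebra.lift ℂ _ (CxDual V) _ _ (Spinor V) _ (twistedAlgebra V) _) c

theorem conjSpinor_smul (c : ℂ) (φ : Spinor V) :
    conjSpinor (c • φ) = (starRingEnd ℂ c) • conjSpinor φ := by
  rw [Algebra.smul_def, map_mul, conjSpinor_algebraMap, Algebra.smul_def]

/-! ## Generalized complex structures -/

/-- The standard symmetric pairing on `V_ℂ ⊕ V_ℂ^*`:
`⟨v + f, w + g⟩ = -(1/2) (f(w) + g(v))`. -/
def pairing (x y : Cx V × CxDual V) : ℂ := -(1 / 2) * (x.2 y.1 + y.2 x.1)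

/-- `E` is maximally isotropic for the standard pairing, i.e. it is isotropic and
`dim_ℂ E = dim_ℝ V`. -/
structure IsMaxIsotropic (E : Submodule ℂ (Cx V × CxDual V)) : Prop where
  isotropic : ∀ x ∈ E, ∀ y ∈ E, pairing x y = 0
  finrank_eq : Module.finrank ℂ E = Module.finrank ℝ V

/-- A generalized complex structure on `V`: a maximally isotropic `E ⊆ V_ℂ ⊕ V_ℂ^*` with
`E ∩ Ē = 0`. -/
structure IsGCStructure (E : Submodule ℂ (Cx V × CxDual V)) : Prop where
  maxIsotropic : IsMaxIsotropic E
  inf_conj : E ⊓ conjSubspace E = ⊥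

/-- The projection `ρ(E)` of `E` to `V_ℂ`. -/
def rho (E : Submodule ℂ (Cx V × CxDual V)) : Submodule ℂ (Cx V) :=
  E.map (LinearMap.fst ℂ (Cx V) (CxDual V))

/-! ## Spinors -/

/-- The Clifford action on a fixed spinor `φ`, as a linear map
`v + f ↦ (v + f) · φ = ι_v φ + f ∧ φ`. -/
def cliffordAct (φ : Spinor V) : (Cx V × CxDual V) →ₗ[ℂ] Spinor V :=
  LinearMap.coprod
    (CliffordAlgebra.contractLeft.flip φ ∘ₗ Module.Dual.eval ℂ (Cx V))
    (LinearMap.mulRight ℂ φ ∘ₗ ExteriorAlgebra.ι ℂ)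

/-- The annihilator of a spinor in `V_ℂ ⊕ V_ℂ^*`. -/
def spinorAnn (φ : Spinor V) : Submodule ℂ (Cx V × CxDual V) := LinearMap.ker (cliffordAct φ)

/-- `φ` is a pure spinor: it is nonzero and its annihilator is maximally isotropic. -/
def IsPureSpinor (φ : Spinor V) : Prop := φ ≠ 0 ∧ IsMaxIsotropic (spinorAnn φ)

/-- `φ` is a representative spinor for `E`: it is a pure spinor with annihilator `E`. -/
def IsRepresentative (φ : Spinor V) (E : Submodule ℂ (Cx V × CxDual V)) : Prop :=
  IsPureSpinor φ ∧ spinorAnn φ = E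

variable (V) in
/-- The space `⋀ⁿ V_ℂ^*` of forms of top degree `n = dim_ℝ V`. -/
abbrev TopForm : Type _ := ⋀[ℂ]^(Module.finrank ℝ V) (CxDual V)

/-- The Mukai pairing: the component of `σ(φ) ∧ ψ` in top degree `n = dim_ℝ V`, where `σ` is
the anti-automorphism of the exterior algebra which is the identity on `V_ℂ^*`
(so `σ = (-1)^(p(p-1)/2)` in degree `p`). -/
def mukai (φ ψ : Spinor V) : TopForm V :=
  DirectSum.decompose (fun i : ℕ => ⋀[ℂ]^i (CxDual V))
    (CliffordAlgebra.reverse φ * ψ) (Module.finrank ℝ V)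

/-- The exponential `exp(u) = ∑ₘ uᵐ / m!` of a two-form `u` on `V`. The powers with
`2 m > dim V` vanish, so the sum over `m ≤ dim V` is the whole exponential series. -/
def expForm (u : ⋀[ℂ]^2 (CxDual V)) : Spinor V :=
  ∑ m ∈ Finset.range (Module.finrank ℝ V + 1), ((m.factorial : ℂ)⁻¹) • (u : Spinor V) ^ m

/-- The spinor `exp(u) ∧ f₁ ∧ ⋯ ∧ f_k`. -/
def spinorOf (u : ⋀[ℂ]^2 (CxDual V)) {k : ℕ} (f : Fin k → CxDual V) : Spinor V :=
  expForm u * ExteriorAlgebra.ιMulti ℂ k f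

/-! ## Subspaces -/

/-- The inclusion `j : W_ℂ → V_ℂ`; its range is `W.baseChange ℂ`. -/
def incl (W : Submodule ℝ V) : Cx W →ₗ[ℂ] Cx V := W.subtype.baseChange ℂ

/-- Restriction `j^* : V_ℂ^* → W_ℂ^*` of linear forms. -/
def restr (W : Submodule ℝ V) : CxDual V →ₗ[ℂ] CxDual W := (incl W).dualMap

/-- Restriction `j^* : ⋀² V_ℂ^* → ⋀² W_ℂ^*` of two-forms. -/
def restrTwo (W : Submodule ℝ V) : ⋀[ℂ]^2 (CxDual V) →ₗ[ℂ] ⋀[ℂ]^2 (CxDual W) :=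
  exteriorPower.map 2 (restr W)

/-- The induced subspace
`E_W = {(ρ(e), ρ^*(e)|_{W_ℂ}) | e ∈ E ∩ (W_ℂ ⊕ V_ℂ^*)} ⊆ W_ℂ ⊕ W_ℂ^*`
(see `mem_induced`). -/
def induced (E : Submodule ℂ (Cx V × CxDual V)) (W : Submodule ℝ V) :
    Submodule ℂ (Cx W × CxDual W) :=
  (E.comap ((incl W).prodMap LinearMap.id)).map (LinearMap.id.prodMap (restr W))

theorem mem_induced (E : Submodule ℂ (Cx V × CxDual V)) (W : Submodule ℝ V)
    (w : Cx W) (g : CxDual W) :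
    (w, g) ∈ induced E W ↔ ∃ f : CxDual V, (incl W w, f) ∈ E ∧ restr W f = g := by
  simp [induced]

/-- `W` is a generalized complex subspace of `(V, E)`: `E_W ∩ Ē_W = 0`. -/
def IsGCSubspace (E : Submodule ℂ (Cx V × CxDual V)) (W : Submodule ℝ V) : Prop :=
  induced E W ⊓ conjSubspace (induced E W) = ⊥

/-- The subspace `ρ(E) ∩ W_ℂ`, viewed inside `W_ℂ`. -/
def rhoInf (E : Submodule ℂ (Cx V × CxDual V)) (W : Submodule ℝ V) : Submodule ℂ (Cx W) :=
  (rho E).comap (incl W)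

/-- The family `f : ι → M` is a basis of the subspace `P`. -/
def IsBasisOf {ι M : Type*} [AddCommGroup M] [Module ℂ M] (f : ι → M) (P : Submodule ℂ M) : Prop :=
  LinearIndependent ℂ f ∧ Submodule.span ℂ (Set.range f) = P

/-- The adaptedness of `f₁, …, f_k` to `E` and `W`: `j^* f₁, …, j^* f_l` form a basis of
`Ann(ρ(E) ∩ W_ℂ) ⊆ W_ℂ^*`, and `f_{l+1}, …, f_k` form a basis of `Ann(ρ(E) + W_ℂ)`. -/
def IsAdapted (E : Submodule ℂ (Cx V × CxDual V)) (W : Submodule ℝ V) {k l : ℕ} (hl : l ≤ k)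
    (f : Fin k → CxDual V) : Prop :=
  IsBasisOf (fun i : Fin l => restr W (f (Fin.castLE hl i))) (rhoInf E W).dualAnnihilator ∧
  IsBasisOf (fun i : {i : Fin k // l ≤ (i : ℕ)} => f i)
    (rho E ⊔ W.baseChange ℂ).dualAnnihilator

end

end

end GCLin

/-!
Everything rests on an explicit description of annihilators. For linearly independent `f₁, …, f_k`
spanning `P ⊆ V_ℂ^*`, the annihilator of `exp(u) ∧ f₁ ∧ ⋯ ∧ f_k` is
`{(v, g) | v ∈ P^⊥, g + ι_v u ∈ P}` (`spinorAnn_spinorOf`): the factor `exp(u)` is invertible, even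
and commutes with forms of degree one, so it may be divided out, and what remains are two forms of
degrees `k + 1` and `k - 1` that must vanish separately. This subspace (`shearSubspace u P`) is the
image of `P^⊥ ⊕ P` under a shear, hence has the right dimension, and it is isotropic because `u` is
alternating.

Conversely a maximally isotropic `E` equals `shearSubspace u (Ann ρ(E))` for a suitable `u`
(`IsMaxIsotropic.exists_eq_shearSubspace`), and a basis of `Ann ρ(E)` can be chosen adapted to `W`,
because restriction to `W_ℂ` maps `Ann ρ(E)` onto `Ann(ρ(E) ∩ W_ℂ)` with kernel `Ann(ρ(E) + W_ℂ)`
(`exists_isAdapted`). Interior products commute with restriction, so the subspace induced on `W` by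
`shearSubspace u P` is again of this form, with `u` and `P` restricted to `W`
(`induced_shearSubspace`); this is the statement about `φ_W`.

The criterion for GC subspaces is Chevalley's theorem that two pure spinors have nonzero Mukai
pairing exactly when their annihilators meet trivially (`mukai_ne_zero_iff`), applied to `φ_W` and
its conjugate. Its ingredients are that the Clifford action is self-adjoint for the Mukai pairing
and that the spinors form an irreducible module for it. If `x ≠ 0` annihilates both spinors, the
Clifford relation writes `φ` as a multiple of `x · (y · φ)`, so that the pairing vanishes. If the
annihilators are complementary, all spinors arise from `ψ` by acting with the annihilator of `φ`,
so a vanishing pairing would put `φ` in the radical of the pairing, which is zero by irreducibility.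
-/

namespace GCLin

open Module CliffordAlgebra

/-! ### Contractions and degrees in the exterior algebra -/

section ExteriorAlgebra

variable {K N : Type*} [Field K] [AddCommGroup N] [Module K N]

/-- Contraction of the exterior algebra of `N` with a linear form `d` on `N`. -/
noncomputable abbrev contr (d : Dual K N) : ExteriorAlgebra K N →ₗ[K] ExteriorAlgebra K N :=
  CliffordAlgebra.contractLeft d

theorem contr_ι_mul (d : Dual K N) (a : N) (b : ExteriorAlgebra K N) :
    contr d (ExteriorAlgebra.ι K a * b) = d a • b - ExteriorAlgebra.ι K a * contr d b :=
  contractLeft_ι_mul (Q := 0) (d := d) a b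

theorem contr_ι (d : Dual K N) (a : N) :
    contr d (ExteriorAlgebra.ι K a) = algebraMap K _ (d a) :=
  contractLeft_ι (Q := 0) (d := d) a

/-- Contraction is an antiderivation. -/
theorem contr_mul (d : Dual K N) (a b : ExteriorAlgebra K N) :
    contr d (a * b) = contr d a * b + involute a * contr d b := by
  induction a using CliffordAlgebra.left_induction with
  | algebraMap r => simp [contr, contractLeft_algebraMap_mul]
  | add x y hx hy => simp only [add_mul, map_add, hx, hy]; abel
  | ι_mul x m hx =>
    have h := contr_ι_mul d m (x * b)
    have h' := contr_ι_mul d m x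
    rw [mul_assoc]
    simp only [ExteriorAlgebra.ι] at h h'
    rw [h, h', hx]
    simp only [map_mul, involute_ι, mul_add, sub_mul, smul_mul_assoc, neg_mul, mul_assoc]
    abel

/-- Reversal exchanges left and right contraction; in the exterior algebra the right contraction
of `a` is the negative of the left contraction of the grade involution of `a`. -/
theorem reverse_contr (d : Dual K N) (a : ExteriorAlgebra K N) :
    reverse (contr d a) = -contr d (involute (reverse a)) := by
  induction a using CliffordAlgebra.left_induction with
  | algebraMap r => simp [contr]
  | add x y hx hy => simp only [map_add, hx, hy]; abel
  | ι_mul x m hx =>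
    have h' := contr_ι_mul d m x
    have h := contr_mul d (involute (reverse x)) (ExteriorAlgebra.ι K m)
    simp only [ExteriorAlgebra.ι] at h h'
    rw [h', map_sub, reverse.map_mul, map_smul, reverse.map_mul, reverse_ι, hx, map_mul,
      involute_ι, mul_neg, map_neg, h, contractLeft_ι, involute_involute,
      Algebra.algebraMap_eq_smul_one]
    simp [add_comm]

theorem ι_mul_mem_exteriorPower (a : N) {p : ℕ} {x : ExteriorAlgebra K N} (hx : x ∈ ⋀[K]^p N) :
    ExteriorAlgebra.ι K a * x ∈ ⋀[K]^(p + 1) N := by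
  have := Submodule.mul_mem_mul (LinearMap.mem_range_self (ExteriorAlgebra.ι K) a) hx
  rwa [← pow_succ'] at this

/-- Contraction lowers the degree by one; in degree zero it vanishes. -/
theorem contr_mem_exteriorPower (d : Dual K N) {p : ℕ} {x : ExteriorAlgebra K N}
    (hx : x ∈ ⋀[K]^p N) : contr d x ∈ ⋀[K]^(p - 1) N ∧ (p = 0 → contr d x = 0) := by
  induction hx using Submodule.pow_induction_on_left' with
  | algebraMap r => simp [contr]
  | add x y i hx hy ihx ihy =>
    rw [map_add]
    exact ⟨add_mem ihx.1 ihy.1, fun h => by rw [ihx.2 h, ihy.2 h, add_zero]⟩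
  | mem_mul m hm i x hx ih =>
    obtain ⟨a, rfl⟩ := hm
    rw [contr_ι_mul]
    refine ⟨sub_mem (Submodule.smul_mem _ _ hx) ?_, by simp⟩
    rcases i with _ | i
    · rw [ih.2 rfl, mul_zero]; exact zero_mem _
    · exact ι_mul_mem_exteriorPower a ih.1

theorem exteriorPower_eq_bot [FiniteDimensional K N] {p : ℕ} (hp : finrank K N < p) :
    ⋀[K]^p N = ⊥ := by
  rw [← Submodule.finrank_eq_zero (R := K), exteriorPower.finrank_eq, Nat.choose_eq_zero_of_lt hp]

/-- The component in degree `p`, as an endomorphism of the exterior algebra. -/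
noncomputable abbrev degreeComp (p : ℕ) : ExteriorAlgebra K N →ₗ[K] ExteriorAlgebra K N :=
  GradedAlgebra.proj (fun i : ℕ => ⋀[K]^i N) p

theorem degreeComp_of_mem {p : ℕ} {x : ExteriorAlgebra K N} (hx : x ∈ ⋀[K]^p N) :
    degreeComp p x = x :=
  DirectSum.decompose_of_mem_same (fun i : ℕ => ⋀[K]^i N) hx

theorem degreeComp_of_mem_ne {p q : ℕ} {x : ExteriorAlgebra K N} (hx : x ∈ ⋀[K]^p N)
    (hpq : p ≠ q) : degreeComp q x = 0 :=
  DirectSum.decompose_of_mem_ne (fun i : ℕ => ⋀[K]^i N) hx hpq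

/-- No contraction has a component of top degree. -/
theorem degreeComp_contr_eq_zero [FiniteDimensional K N] (d : Dual K N)
    (x : ExteriorAlgebra K N) : degreeComp (finrank K N) (contr d x) = 0 := by
  induction x using DirectSum.Decomposition.inductionOn (fun i : ℕ => ⋀[K]^i N) with
  | zero => rw [map_zero, map_zero]
  | add x y hx hy => rw [map_add, map_add, hx, hy, add_zero]
  | @homogeneous i x =>
    have h := contr_mem_exteriorPower d x.2
    rcases i with _ | i
    · rw [h.2 rfl, map_zero]
    · by_cases hi : i = finrank K N
      · have hx : (x : ExteriorAlgebra K N) ∈ (⊥ : Submodule K (ExteriorAlgebra K N)) := by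
          rw [← exteriorPower_eq_bot (K := K) (N := N) (p := i + 1) (by omega)]; exact x.2
        rw [(Submodule.mem_bot K).1 hx, map_zero, map_zero]
      · exact degreeComp_of_mem_ne h.1 (by omega)

theorem contr_comm (d d' : Dual K N) (x : ExteriorAlgebra K N) :
    contr d (contr d' x) = -contr d' (contr d x) :=
  contractLeft_comm _ _ x

theorem ι_mul_ι_mul_comm (a b : N) (x : ExteriorAlgebra K N) :
    ExteriorAlgebra.ι K a * (ExteriorAlgebra.ι K b * x) =
      -(ExteriorAlgebra.ι K b * (ExteriorAlgebra.ι K a * x)) := by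
  rw [← mul_assoc, ← mul_assoc, ← neg_mul, eq_neg_of_add_eq_zero_left
    (ExteriorAlgebra.ι_add_mul_swap a b)]

/-- An element killed by all contractions is a scalar: the number operator
`∑ eⁱ ∧ ι_{e_i}` acts on degree `p` as multiplication by `p`. -/
theorem exists_algebraMap_of_contr_eq_zero [CharZero K] [FiniteDimensional K N]
    {x : ExteriorAlgebra K N} (hx : ∀ d : Dual K N, contr d x = 0) :
    ∃ c : K, x = algebraMap K _ c := by
  let b := Module.finBasis K N
  let num : ExteriorAlgebra K N →ₗ[K] ExteriorAlgebra K N :=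
    ∑ i, LinearMap.mulLeft K (ExteriorAlgebra.ι K (b i)) ∘ₗ contr (b.coord i)
  have hnum (y) : num y = ∑ i, ExteriorAlgebra.ι K (b i) * contr (b.coord i) y := by
    simp [num, LinearMap.sum_apply]
  have hstep (a : N) (y) : num (ExteriorAlgebra.ι K a * y) =
      ExteriorAlgebra.ι K a * y + ExteriorAlgebra.ι K a * num y := by
    rw [hnum, hnum, Finset.mul_sum]
    conv_rhs => enter [1]; rw [← b.sum_repr a, map_sum, Finset.sum_mul]
    rw [← Finset.sum_add_distrib]
    refine Finset.sum_congr rfl fun i _ => ?_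
    rw [contr_ι_mul, mul_sub, ι_mul_ι_mul_comm (b i) a, sub_neg_eq_add]
    simp
  have hdeg : ∀ (p : ℕ) (y : ExteriorAlgebra K N), y ∈ ⋀[K]^p N → num y = (p : K) • y := by
    intro p y hy
    induction hy using Submodule.pow_induction_on_left' with
    | algebraMap r => simp [hnum, contr]
    | add x y i hx hy ihx ihy => rw [map_add, ihx, ihy, smul_add]
    | mem_mul m hm i x hx ih =>
      obtain ⟨a, rfl⟩ := hm
      rw [hstep, ih]
      simp [add_smul, add_comm]
  have hcomp (p : ℕ) : degreeComp p (num x) = (p : K) • degreeComp p x := by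
    clear hx
    induction x using DirectSum.Decomposition.inductionOn (fun i : ℕ => ⋀[K]^i N) with
    | zero => rw [map_zero, map_zero, smul_zero]
    | add x y hx hy => rw [map_add, map_add, map_add, hx, hy, smul_add]
    | @homogeneous i x =>
      rw [hdeg i _ x.2]
      by_cases hi : i = p
      · subst hi; rw [map_smul]
      · rw [map_smul, degreeComp_of_mem_ne x.2 hi, smul_zero, smul_zero]
  have hzero : num x = 0 := by simp [hnum, hx]
  have hpos (p : ℕ) (hp : p ≠ 0) : degreeComp p x = 0 := by
    have := hcomp p
    rw [hzero, map_zero] at this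
    exact (smul_eq_zero.1 this.symm).resolve_left (by exact_mod_cast hp)
  have hx0 : x ∈ ⋀[K]^0 N := by
    classical
    rw [← DirectSum.sum_support_decompose (fun i : ℕ => ⋀[K]^i N) x]
    refine Submodule.sum_mem _ fun i _ => ?_
    rcases i with _ | i
    · exact SetLike.coe_mem _
    · rw [show ((DirectSum.decompose (fun i : ℕ => ⋀[K]^i N) x (i + 1) : ExteriorAlgebra K N)) = 0
        from hpos _ (by simp)]
      exact zero_mem _
  obtain ⟨c, hc⟩ := Submodule.mem_one.1 (by simpa using hx0)
  exact ⟨c, hc.symm⟩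

/-- The exterior algebra is an irreducible module over contractions and exterior
multiplications. -/
theorem eq_top_of_contr_mem_of_ι_mul_mem [CharZero K] [FiniteDimensional K N]
    {R : Submodule K (ExteriorAlgebra K N)} (hR : R ≠ ⊥)
    (hcontr : ∀ (d : Dual K N), ∀ x ∈ R, contr d x ∈ R)
    (hι : ∀ (a : N), ∀ x ∈ R, ExteriorAlgebra.ι K a * x ∈ R) : R = ⊤ := by
  let b := Module.finBasis K (Dual K N)
  -- Contract successively with the elements of a basis, as long as the result is nonzero.
  have key : ∀ s : Finset (Fin (finrank K (Dual K N))),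
      ∃ x ∈ R, x ≠ 0 ∧ ∀ i ∈ s, contr (b i) x = 0 := by
    intro s
    induction s using Finset.induction_on with
    | empty =>
      obtain ⟨x, hx, hx0⟩ := Submodule.exists_mem_ne_zero_of_ne_bot hR
      exact ⟨x, hx, hx0, by simp⟩
    | insert j s _ ih =>
      obtain ⟨x, hx, hx0, hs⟩ := ih
      by_cases hj : contr (b j) x = 0
      · exact ⟨x, hx, hx0, by simpa [hj] using hs⟩
      · refine ⟨_, hcontr (b j) x hx, hj, fun i hi => ?_⟩
        rcases Finset.mem_insert.1 hi with rfl | hi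
        · exact contractLeft_contractLeft _ x
        · rw [contr_comm, hs i hi, map_zero, neg_zero]
  obtain ⟨x, hx, hx0, hall⟩ := key Finset.univ
  obtain ⟨c, rfl⟩ := exists_algebraMap_of_contr_eq_zero (x := x) fun d => by
    rw [← b.sum_repr d]
    simp only [contr, map_sum, map_smul, LinearMap.sum_apply, LinearMap.smul_apply]
    exact Finset.sum_eq_zero fun i _ => by rw [hall i (Finset.mem_univ i), smul_zero]
  have hc : c ≠ 0 := by rintro rfl; simp at hx0
  have hscalar (r : K) : algebraMap K (ExteriorAlgebra K N) r ∈ R := by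
    have := R.smul_mem (r * c⁻¹) hx
    rwa [Algebra.smul_def, ← map_mul, mul_assoc, inv_mul_cancel₀ hc, mul_one] at this
  rw [eq_top_iff]
  rintro y -
  induction y using CliffordAlgebra.left_induction with
  | algebraMap r => exact hscalar r
  | add x y hx hy => exact R.add_mem hx hy
  | ι_mul x m hx => exact hι m x hx

/-! ### Decomposable elements -/

theorem ι_mul_ιMulti {k : ℕ} (a : N) (f : Fin k → N) :
    ExteriorAlgebra.ι K a * ExteriorAlgebra.ιMulti K k f =
      ExteriorAlgebra.ιMulti K (k + 1) (Fin.cons a f) := by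
  rw [ExteriorAlgebra.ιMulti_succ_apply]; simp [Matrix.vecTail, Function.comp_def]

theorem ιMulti_mem_exteriorPower {k : ℕ} (f : Fin k → N) :
    ExteriorAlgebra.ιMulti K k f ∈ ⋀[K]^k N :=
  ExteriorAlgebra.ιMulti_range K k (Set.mem_range_self f)

theorem contr_ιMulti_eq_zero (d : Dual K N) {k : ℕ} {f : Fin k → N} (h : ∀ i, d (f i) = 0) :
    contr d (ExteriorAlgebra.ιMulti K k f) = 0 := by
  induction k with
  | zero => simp [contr]
  | succ k ih =>
    rw [← Fin.cons_self_tail f, ← ι_mul_ιMulti, contr_ι_mul, ih (f := Fin.tail f) (fun i => h i.succ), h 0]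
    simp

theorem ιMulti_ne_zero {k : ℕ} {f : Fin k → N} (hf : LinearIndependent K f) :
    ExteriorAlgebra.ιMulti K k f ≠ 0 := by
  induction k with
  | zero => simp
  | succ k ih =>
    -- A linear form that is nonzero on `f 0` and kills the other `f i` contracts the product to a
    -- multiple of the product of those others.
    rw [← Fin.cons_self_tail f] at hf ⊢
    rw [linearIndependent_finCons] at hf
    obtain ⟨d, hd, hd'⟩ := Submodule.exists_le_ker_of_notMem hf.2
    intro h0
    have h := congrArg (contr d) h0
    rw [← ι_mul_ιMulti, contr_ι_mul, contr_ιMulti_eq_zero d fun i =>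
      hd' (Submodule.subset_span (Set.mem_range_self i)), mul_zero, sub_zero, map_zero] at h
    exact (smul_ne_zero hd (ih hf.1)) h

theorem ι_mul_ιMulti_eq_zero_iff {k : ℕ} {f : Fin k → N} (hf : LinearIndependent K f) (a : N) :
    ExteriorAlgebra.ι K a * ExteriorAlgebra.ιMulti K k f = 0 ↔
      a ∈ Submodule.span K (Set.range f) := by
  rw [ι_mul_ιMulti]
  constructor
  · intro h
    by_contra ha
    exact ιMulti_ne_zero (linearIndependent_finCons.2 ⟨hf, ha⟩) h
  · intro h
    refine AlternatingMap.map_linearDependent _ _ fun hl => ?_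
    exact (linearIndependent_finCons.1 hl).2 h

theorem contr_ιMulti_eq_zero_iff {k : ℕ} {f : Fin k → N} (hf : LinearIndependent K f)
    (d : Dual K N) :
    contr d (ExteriorAlgebra.ιMulti K k f) = 0 ↔ ∀ i, d (f i) = 0 := by
  refine ⟨fun h i => ?_, contr_ιMulti_eq_zero d⟩
  -- Contract the relation `f i ∧ (f₁ ∧ ⋯ ∧ f_k) = 0`.
  have h' := congrArg (contr d)
    ((ι_mul_ιMulti_eq_zero_iff hf (f i)).2 (Submodule.subset_span (Set.mem_range_self i)))
  rw [contr_ι_mul, h, mul_zero, sub_zero, map_zero] at h'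
  exact (smul_eq_zero.1 h').resolve_right (ιMulti_ne_zero hf)

end ExteriorAlgebra

/-! ### Two-forms and their interior products -/

section TwoForm

variable {K N : Type*} [Field K] [AddCommGroup N] [Module K N]

theorem mem_exteriorPower_two_induction {C : ExteriorAlgebra K N → Prop}
    (hmul : ∀ a b : N, C (ExteriorAlgebra.ι K a * ExteriorAlgebra.ι K b))
    (hadd : ∀ x y, C x → C y → C (x + y)) {u : ExteriorAlgebra K N} (hu : u ∈ ⋀[K]^2 N) : C u := by
  rw [ExteriorAlgebra.exteriorPower, pow_two] at hu
  induction hu using Submodule.mul_induction_on' with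
  | mem_mul_mem x hx y hy =>
    obtain ⟨a, rfl⟩ := hx
    obtain ⟨b, rfl⟩ := hy
    exact hmul a b
  | add x _ y _ hx hy => exact hadd x y hx hy

theorem commute_ι_of_mem_two {u : ExteriorAlgebra K N} (hu : u ∈ ⋀[K]^2 N) (a : N) :
    Commute u (ExteriorAlgebra.ι K a) := by
  refine mem_exteriorPower_two_induction
    (C := fun u => Commute u (ExteriorAlgebra.ι K a)) (fun b c => ?_) (fun x y hx hy => hx.add_left hy) hu
  rw [commute_iff_eq, mul_assoc, eq_neg_of_add_eq_zero_left (ExteriorAlgebra.ι_add_mul_swap c a),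
    mul_neg, ι_mul_ι_mul_comm b a, neg_neg]

theorem involute_of_mem_two {u : ExteriorAlgebra K N} (hu : u ∈ ⋀[K]^2 N) : involute u = u := by
  refine mem_exteriorPower_two_induction
    (C := fun u => involute u = u) (fun a b => ?_) (fun x y hx hy => ?_) hu
  · rw [map_mul, ExteriorAlgebra.ι, involute_ι, involute_ι, neg_mul_neg]
  · rw [map_add, hx, hy]

/-- The interior product `d ↦ ι_d u ∈ N` of linear forms on `N` with a bivector `u ∈ ⋀² N`. It is
the element of `N` whose image in the exterior algebra is the contraction of `u` with `d`
(see `ι_interior`). -/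
noncomputable def interior (u : ⋀[K]^2 N) : Dual K N →ₗ[K] N :=
  ExteriorAlgebra.ιInv ∘ₗ CliffordAlgebra.contractLeft.flip (u : ExteriorAlgebra K N)

theorem ι_interior (u : ⋀[K]^2 N) (d : Dual K N) :
    ExteriorAlgebra.ι K (interior u d) = contr d (u : ExteriorAlgebra K N) := by
  have h := (contr_mem_exteriorPower d u.2).1
  rw [ExteriorAlgebra.exteriorPower, pow_one] at h
  obtain ⟨a, ha⟩ := h
  change ExteriorAlgebra.ι K (ExteriorAlgebra.ιInv (contr d (u : ExteriorAlgebra K N))) = _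
  rw [← ha, ExteriorAlgebra.ι_leftInverse]

theorem apply_interior (u : ⋀[K]^2 N) (d d' : Dual K N) :
    d (interior u d') = -d' (interior u d) := by
  have h := contr_comm d d' (u : ExteriorAlgebra K N)
  rw [← ι_interior, ← ι_interior] at h
  rw [contr_ι, contr_ι, ← map_neg] at h
  exact ExteriorAlgebra.algebraMap_leftInverse N |>.injective h

theorem interior_eq_of_coe_eq_sum {ι : Type*} [Fintype ι] (u : ⋀[K]^2 N) (a b : ι → N) (c : K)
    (hu : (u : ExteriorAlgebra K N) =
      c • ∑ i, ExteriorAlgebra.ι K (a i) * ExteriorAlgebra.ι K (b i)) (d : Dual K N) :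
    interior u d = c • ∑ i, (d (a i) • b i - d (b i) • a i) := by
  apply (ExteriorAlgebra.ι_leftInverse (R := K) (M := N)).injective
  rw [ι_interior, hu, map_smul, map_sum, map_smul, map_sum]
  refine congrArg _ (Finset.sum_congr rfl fun i _ => ?_)
  rw [contr_ι_mul, contr_ι, map_sub, map_smul, map_smul, Algebra.algebraMap_eq_smul_one,
    mul_smul_comm, mul_one]

theorem contr_two_pow_succ {u : ExteriorAlgebra K N} (hu : u ∈ ⋀[K]^2 N) (d : Dual K N) (m : ℕ) :
    contr d (u ^ (m + 1)) = ((m + 1 : ℕ) : K) • (u ^ m * contr d u) := by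
  induction m with
  | zero => simp
  | succ m ih =>
    have hcomm : Commute u (contr d u) := by
      rw [← ι_interior ⟨u, hu⟩ d]; exact commute_ι_of_mem_two hu _
    rw [pow_succ' u (m + 1), contr_mul, ih, involute_of_mem_two hu, mul_smul_comm, ← mul_assoc,
      ← pow_succ', (hcomm.pow_left (m + 1)).eq.symm, Nat.cast_succ (m + 1), add_smul, one_smul,
      add_comm]

theorem pow_mem_exteriorPower {u : ExteriorAlgebra K N} {p : ℕ} (hu : u ∈ ⋀[K]^p N) (m : ℕ) :
    u ^ m ∈ ⋀[K]^(m * p) N :=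
  SetLike.pow_mem_graded (A := fun i : ℕ => ⋀[K]^i N) m hu

end TwoForm

/-! ### Annihilators of the spinors `exp(u) ∧ f₁ ∧ ⋯ ∧ f_k` -/

section Spinor

variable {V : Type*} [AddCommGroup V] [Module ℝ V]

theorem finrank_cxDual [FiniteDimensional ℝ V] :
    finrank ℂ (CxDual V) = finrank ℝ V := by
  rw [Subspace.dual_finrank_eq, Module.finrank_baseChange]

theorem cliffordAct_apply (φ : Spinor V) (x : Cx V × CxDual V) :
    cliffordAct φ x = contr (Dual.eval ℂ (Cx V) x.1) φ + ExteriorAlgebra.ι ℂ x.2 * φ := rfl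

theorem mem_spinorAnn {φ : Spinor V} {x : Cx V × CxDual V} :
    x ∈ spinorAnn φ ↔ contr (Dual.eval ℂ (Cx V) x.1) φ + ExteriorAlgebra.ι ℂ x.2 * φ = 0 :=
  Iff.rfl

theorem commute_expForm_ι (u : ⋀[ℂ]^2 (CxDual V)) (a : CxDual V) :
    Commute (expForm u) (ExteriorAlgebra.ι ℂ a) :=
  Commute.sum_left _ _ _ fun _ _ => ((commute_ι_of_mem_two u.2 a).pow_left _).smul_left _

theorem involute_expForm (u : ⋀[ℂ]^2 (CxDual V)) : involute (expForm u) = expForm u := by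
  simp [expForm, involute_of_mem_two u.2]

/-- `exp(u)` is `1` plus a nilpotent element. -/
theorem isUnit_expForm [FiniteDimensional ℝ V] (u : ⋀[ℂ]^2 (CxDual V)) :
    IsUnit (expForm u) := by
  have hnil : IsNilpotent (u : Spinor V) := by
    refine ⟨finrank ℝ V + 1, ?_⟩
    have h := pow_mem_exteriorPower u.2 (finrank ℝ V + 1)
    rwa [exteriorPower_eq_bot (by rw [finrank_cxDual]; omega), Submodule.mem_bot] at h
  have hsum : expForm u = 1 + (u : Spinor V) * ∑ m ∈ Finset.range (finrank ℝ V),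
      (((m + 1).factorial : ℂ)⁻¹) • (u : Spinor V) ^ m := by
    rw [expForm, Finset.sum_range_succ', Finset.mul_sum, add_comm]
    simp [pow_succ']
  rw [hsum]
  refine IsNilpotent.isUnit_one_add (Commute.isNilpotent_mul_right ?_ hnil)
  exact Commute.sum_right _ _ _ fun _ _ => ((Commute.refl _).pow_right _).smul_right _

theorem contr_expForm [FiniteDimensional ℝ V] (u : ⋀[ℂ]^2 (CxDual V)) (d : Dual ℂ (CxDual V)) :
    contr d (expForm u) = expForm u * contr d (u : Spinor V) := by
  have htop : (u : Spinor V) ^ finrank ℝ V * contr d (u : Spinor V) = 0 := by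
    rw [← ι_interior, ((commute_ι_of_mem_two u.2 _).pow_left _).eq]
    have h := ι_mul_mem_exteriorPower (interior u d) (pow_mem_exteriorPower u.2 (finrank ℝ V))
    rwa [exteriorPower_eq_bot (by rw [finrank_cxDual]; omega), Submodule.mem_bot] at h
  -- Differentiating the series term by term shifts it, and the last term of the product vanishes.
  rw [expForm, map_sum, Finset.sum_range_succ', Finset.sum_range_succ, add_mul, smul_mul_assoc,
    htop, smul_zero, Finset.sum_mul]
  congr 1
  · refine Finset.sum_congr rfl fun m _ => ?_
    rw [map_smul, contr_two_pow_succ u.2, smul_smul, smul_mul_assoc, Nat.factorial_succ]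
    congr 1
    have : ((m : ℂ) + 1) ≠ 0 := by exact_mod_cast m.succ_ne_zero
    push_cast
    field_simp
  · simp [contr]

/-- The subspace `{(v, g) | v ∈ P^⊥, g + ι_v u ∈ P}` attached to a two-form `u` and a space `P` of
linear forms: the annihilator of `exp(u) ∧ f₁ ∧ ⋯ ∧ f_k` for a basis `f` of `P`. -/
noncomputable def shearSubspace (u : ⋀[ℂ]^2 (CxDual V)) (P : Submodule ℂ (CxDual V)) :
    Submodule ℂ (Cx V × CxDual V) :=
  (P.dualCoannihilator.prod P).comap
    (LinearEquiv.skewProd (.refl ℂ (Cx V)) (.refl ℂ (CxDual V))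
      (interior u ∘ₗ Dual.eval ℂ (Cx V))).toLinearMap

theorem mem_shearSubspace {u : ⋀[ℂ]^2 (CxDual V)} {P : Submodule ℂ (CxDual V)}
    {x : Cx V × CxDual V} : x ∈ shearSubspace u P ↔
      (∀ p ∈ P, p x.1 = 0) ∧ x.2 + interior u (Dual.eval ℂ (Cx V) x.1) ∈ P := by
  simp [shearSubspace, Submodule.mem_dualCoannihilator]

theorem finrank_shearSubspace [FiniteDimensional ℝ V] (u : ⋀[ℂ]^2 (CxDual V))
    (P : Submodule ℂ (CxDual V)) : finrank ℂ (shearSubspace u P) = finrank ℝ V := by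
  rw [shearSubspace, (LinearEquiv.ofSubmodule' _ _).finrank_eq,
    ← Submodule.range_subtype P.dualCoannihilator, ← Submodule.range_subtype P,
    ← LinearMap.range_prodMap, LinearMap.finrank_range_of_inj
      (Prod.map_injective.2 ⟨Subtype.val_injective, Subtype.val_injective⟩),
    Submodule.range_subtype, Module.finrank_prod, add_comm,
    Subspace.finrank_add_finrank_dualCoannihilator_eq, Module.finrank_baseChange]

theorem isMaxIsotropic_shearSubspace [FiniteDimensional ℝ V] (u : ⋀[ℂ]^2 (CxDual V))
    (P : Submodule ℂ (CxDual V)) : IsMaxIsotropic (shearSubspace u P) where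
  isotropic x hx y hy := by
    rw [mem_shearSubspace] at hx hy
    have h1 := hx.1 _ hy.2
    have h2 := hy.1 _ hx.2
    have h3 := apply_interior u (Dual.eval ℂ (Cx V) x.1) (Dual.eval ℂ (Cx V) y.1)
    simp only [LinearMap.add_apply, Dual.eval_apply] at h1 h2 h3
    rw [pairing]
    linear_combination -(1 / 2 : ℂ) * (h1 + h2 - h3)
  finrank_eq := finrank_shearSubspace u P

theorem cliffordAct_spinorOf [FiniteDimensional ℝ V] (u : ⋀[ℂ]^2 (CxDual V)) {k : ℕ}
    (f : Fin k → CxDual V) (x : Cx V × CxDual V) :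
    cliffordAct (spinorOf u f) x = expForm u *
      (ExteriorAlgebra.ι ℂ (x.2 + interior u (Dual.eval ℂ (Cx V) x.1)) *
          ExteriorAlgebra.ιMulti ℂ k f +
        contr (Dual.eval ℂ (Cx V) x.1) (ExteriorAlgebra.ιMulti ℂ k f)) := by
  rw [cliffordAct_apply, spinorOf, contr_mul, involute_expForm, contr_expForm, ← ι_interior,
    ← mul_assoc (ExteriorAlgebra.ι ℂ x.2), ← (commute_expForm_ι u x.2).eq, map_add]
  simp only [mul_add, add_mul, mul_assoc]
  abel

theorem spinorAnn_spinorOf [FiniteDimensional ℝ V] (u : ⋀[ℂ]^2 (CxDual V)) {k : ℕ}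
    {f : Fin k → CxDual V} (hf : LinearIndependent ℂ f) :
    spinorAnn (spinorOf u f) = shearSubspace u (Submodule.span ℂ (Set.range f)) := by
  ext x
  rw [spinorAnn, LinearMap.mem_ker, cliffordAct_spinorOf, (isUnit_expForm u).mul_right_eq_zero,
    mem_shearSubspace, ← ι_mul_ιMulti_eq_zero_iff hf]
  have hspan : (∀ p ∈ Submodule.span ℂ (Set.range f), p x.1 = 0) ↔
      contr (Dual.eval ℂ (Cx V) x.1) (ExteriorAlgebra.ιMulti ℂ k f) = 0 := by
    rw [contr_ιMulti_eq_zero_iff hf]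
    refine ⟨fun h i => h _ (Submodule.subset_span ⟨i, rfl⟩), fun h p hp => ?_⟩
    have hle : Submodule.span ℂ (Set.range f) ≤ LinearMap.ker (Dual.eval ℂ (Cx V) x.1) := by
      rw [Submodule.span_le]; rintro _ ⟨i, rfl⟩; exact h i
    exact hle hp
  rw [hspan]
  refine ⟨fun h => ?_, fun h => by rw [h.1, h.2, add_zero]⟩
  -- The two summands have the different degrees `k + 1` and `k - 1`.
  set a := x.2 + interior u (Dual.eval ℂ (Cx V) x.1)
  have h' := congrArg (degreeComp (k + 1)) h
  rw [map_add, degreeComp_of_mem (ι_mul_mem_exteriorPower a (ιMulti_mem_exteriorPower f)),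
    degreeComp_of_mem_ne (contr_mem_exteriorPower _ (ιMulti_mem_exteriorPower f)).1 (by omega),
    map_zero, add_zero] at h'
  exact ⟨by rwa [h', zero_add] at h, h'⟩

theorem isPureSpinor_spinorOf [FiniteDimensional ℝ V] (u : ⋀[ℂ]^2 (CxDual V)) {k : ℕ}
    {f : Fin k → CxDual V} (hf : LinearIndependent ℂ f) : IsPureSpinor (spinorOf u f) := by
  refine ⟨?_, ?_⟩
  · rw [spinorOf, Ne, (isUnit_expForm u).mul_right_eq_zero]
    exact ιMulti_ne_zero hf
  · rw [spinorAnn_spinorOf u hf]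
    exact isMaxIsotropic_shearSubspace _ _

theorem linearIndependent_of_spinorOf_ne_zero {u : ⋀[ℂ]^2 (CxDual V)} {k : ℕ}
    {f : Fin k → CxDual V} (h : spinorOf u f ≠ 0) : LinearIndependent ℂ f := by
  by_contra hf
  exact h (by rw [spinorOf, AlternatingMap.map_linearDependent _ _ hf, mul_zero])

end Spinor

/-! ### The Mukai pairing and transversality of annihilators -/

section Mukai

variable {V : Type*} [AddCommGroup V] [Module ℝ V]

theorem mukai_eq_zero_iff (φ ψ : Spinor V) :
    mukai φ ψ = 0 ↔ degreeComp (finrank ℝ V) (reverse φ * ψ) = 0 :=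
  (Submodule.coe_eq_zero (x := mukai φ ψ)).symm

/-- The Clifford action is self-adjoint for the Mukai pairing. -/
theorem mukai_cliffordAct_left [FiniteDimensional ℝ V] (φ ψ : Spinor V) (x : Cx V × CxDual V) :
    degreeComp (finrank ℝ V) (reverse (cliffordAct φ x) * ψ) =
      degreeComp (finrank ℝ V) (reverse φ * cliffordAct ψ x) := by
  set d := Dual.eval ℂ (Cx V) x.1 with hd
  -- The contractions of both factors combine to the contraction of a product.
  have h0 := degreeComp_contr_eq_zero d (involute (reverse φ) * ψ)
  rw [finrank_cxDual, contr_mul, involute_involute, map_add] at h0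
  rw [cliffordAct_apply, cliffordAct_apply, map_add, reverse_contr, reverse.map_mul,
    ExteriorAlgebra.ι, reverse_ι, add_mul, mul_add, map_add, map_add, neg_mul, map_neg, mul_assoc,
    neg_eq_of_add_eq_zero_right h0]

theorem mukai_cliffordAct_eq_zero_iff [FiniteDimensional ℝ V] (φ ψ : Spinor V)
    (x : Cx V × CxDual V) :
    mukai (cliffordAct φ x) ψ = 0 ↔ mukai φ (cliffordAct ψ x) = 0 := by
  rw [mukai_eq_zero_iff, mukai_eq_zero_iff, mukai_cliffordAct_left]

/-- The Clifford relation `x · (y · φ) + y · (x · φ) = -2 ⟨x, y⟩ φ`. -/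
theorem cliffordAct_cliffordAct_add (φ : Spinor V) (x y : Cx V × CxDual V) :
    cliffordAct (cliffordAct φ y) x + cliffordAct (cliffordAct φ x) y =
      (x.2 y.1 + y.2 x.1) • φ := by
  simp only [cliffordAct_apply, map_add, mul_add, contr_ι_mul, Dual.eval_apply]
  rw [contr_comm (Dual.eval ℂ (Cx V) x.1), ι_mul_ι_mul_comm x.2, add_smul]
  abel

theorem cliffordAct_add_left (φ ψ : Spinor V) (x : Cx V × CxDual V) :
    cliffordAct (φ + ψ) x = cliffordAct φ x + cliffordAct ψ x := by
  simp only [cliffordAct_apply, map_add, mul_add]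
  abel

theorem cliffordAct_smul_left (c : ℂ) (φ : Spinor V) (x : Cx V × CxDual V) :
    cliffordAct (c • φ) x = c • cliffordAct φ x := by
  simp only [cliffordAct_apply, map_smul, mul_smul_comm, smul_add]

/-- The spinors form an irreducible module for the Clifford action. -/
theorem eq_top_of_cliffordAct_mem [FiniteDimensional ℝ V] {R : Submodule ℂ (Spinor V)}
    (hR : R ≠ ⊥) (h : ∀ φ ∈ R, ∀ x, cliffordAct φ x ∈ R) : R = ⊤ := by
  refine eq_top_of_contr_mem_of_ι_mul_mem hR (fun d φ hφ => ?_) (fun a φ hφ => ?_)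
  · obtain ⟨v, rfl⟩ := (Module.evalEquiv ℂ (Cx V)).surjective d
    simpa [cliffordAct_apply] using h φ hφ (v, 0)
  · simpa [cliffordAct_apply] using h φ hφ (0, a)

/-- The Mukai pairing is nondegenerate: its radical is stable under the Clifford action, and hence
zero by irreducibility. -/
theorem eq_zero_of_forall_mukai_eq_zero [FiniteDimensional ℝ V] {φ : Spinor V}
    (h : ∀ ψ, mukai φ ψ = 0) : φ = 0 := by
  by_contra hφ
  let R : Submodule ℂ (Spinor V) :=
    { carrier := {φ | ∀ ψ, mukai φ ψ = 0}
      add_mem' := fun {a b} ha hb ψ => by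
        have ha := ha ψ
        have hb := hb ψ
        rw [mukai_eq_zero_iff] at *
        rw [map_add, add_mul, map_add, ha, hb, add_zero]
      zero_mem' := fun ψ => by rw [mukai_eq_zero_iff, map_zero, zero_mul, map_zero]
      smul_mem' := fun c a ha ψ => by
        have ha := ha ψ
        rw [mukai_eq_zero_iff] at *
        rw [map_smul, smul_mul_assoc, map_smul, ha, smul_zero] }
  have hR : R = ⊤ := eq_top_of_cliffordAct_mem
    (fun h0 => hφ ((Submodule.mem_bot ℂ).1 (h0 ▸ (show φ ∈ R from h))))
    fun φ hφ x ψ => (mukai_cliffordAct_eq_zero_iff φ ψ x).2 (hφ _)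
  -- The radical would contain `1`, but there are nonzero forms of top degree.
  have h1 : (1 : Spinor V) ∈ R := hR ▸ Submodule.mem_top
  have hfin : finrank ℂ (TopForm V) = 1 := by
    rw [exteriorPower.finrank_eq, finrank_cxDual, Nat.choose_self]
  obtain ⟨t, ht⟩ := finrank_pos_iff_exists_ne_zero.1 (hfin ▸ one_pos : 0 < finrank ℂ (TopForm V))
  have h2 := (mukai_eq_zero_iff _ _).1 (h1 t)
  rw [reverse.map_one, one_mul, degreeComp_of_mem t.2] at h2
  exact ht (Submodule.coe_eq_zero.1 h2)

theorem exists_pairing_ne_zero {x : Cx V × CxDual V} (hx : x ≠ 0) :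
    ∃ y : Cx V × CxDual V, x.2 y.1 + y.2 x.1 ≠ 0 := by
  by_contra! h
  refine hx (Prod.ext ?_ ?_)
  · exact (forall_dual_apply_eq_zero_iff ℂ _).1 fun g => by simpa using h (0, g)
  · refine LinearMap.ext fun v => ?_
    simpa using h (v, 0)

theorem mukai_eq_zero_of_mem_spinorAnn [FiniteDimensional ℝ V] {φ ψ : Spinor V}
    {x : Cx V × CxDual V} (hx : x ≠ 0) (hφ : x ∈ spinorAnn φ) (hψ : x ∈ spinorAnn ψ) :
    mukai φ ψ = 0 := by
  obtain ⟨y, hy⟩ := exists_pairing_ne_zero hx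
  have hφ' : cliffordAct φ x = 0 := hφ
  have hψ' : cliffordAct ψ x = 0 := hψ
  have h := cliffordAct_cliffordAct_add φ x y
  rw [hφ', show cliffordAct (0 : Spinor V) y = 0 by simp [cliffordAct_apply], add_zero] at h
  have h1 : mukai (cliffordAct (cliffordAct φ y) x) ψ = 0 := by
    rw [mukai_cliffordAct_eq_zero_iff, hψ', mukai_eq_zero_iff, mul_zero, map_zero]
  rw [mukai_eq_zero_iff, h, map_smul, smul_mul_assoc, map_smul] at h1
  exact (mukai_eq_zero_iff _ _).2 ((smul_eq_zero.1 h1).resolve_left hy)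

/-- Chevalley's criterion: pure spinors with transverse annihilators have nonzero Mukai pairing.
Otherwise the orthogonal of `φ` contains `ψ` and the image of the Clifford action of the
annihilator `L` of `φ`; but `ψ` generates all spinors under `L` alone, since the annihilator of
`ψ` is complementary to `L`. -/
theorem mukai_ne_zero_of_inf_eq_bot [FiniteDimensional ℝ V] {φ ψ : Spinor V}
    (hφ : IsPureSpinor φ) (hψ : IsPureSpinor ψ) (h : spinorAnn φ ⊓ spinorAnn ψ = ⊥) :
    mukai φ ψ ≠ 0 := by
  intro h0
  have hsup : spinorAnn φ ⊔ spinorAnn ψ = ⊤ := by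
    have h1 := Submodule.finrank_sup_add_finrank_inf_eq (spinorAnn φ) (spinorAnn ψ)
    rw [h, finrank_bot, add_zero, hφ.2.finrank_eq, hψ.2.finrank_eq] at h1
    refine Submodule.eq_top_of_finrank_eq ?_
    rw [h1, Module.finrank_prod, finrank_cxDual, Module.finrank_baseChange]
  let R : Submodule ℂ (Spinor V) := sInf {R | ψ ∈ R ∧
    ∀ s ∈ R, ∀ x ∈ spinorAnn φ, cliffordAct s x ∈ R}
  have hψR : ψ ∈ R := by
    rw [Submodule.mem_sInf]; exact fun R hR => hR.1
  have hL : ∀ s ∈ R, ∀ x ∈ spinorAnn φ, cliffordAct s x ∈ R := by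
    intro s hs x hx
    rw [Submodule.mem_sInf] at hs ⊢
    exact fun R hR => hR.2 s (hs R hR) x hx
  have hmin (Q : Submodule ℂ (Spinor V)) (h1 : ψ ∈ Q)
      (h2 : ∀ s ∈ Q, ∀ x ∈ spinorAnn φ, cliffordAct s x ∈ Q) : R ≤ Q := sInf_le ⟨h1, h2⟩
  -- Stability under the annihilator of `ψ`: move it past the elements of `L` until it kills `ψ`.
  have hL' : ∀ s ∈ R, ∀ y ∈ spinorAnn ψ, cliffordAct s y ∈ R := by
    let Q : Submodule ℂ (Spinor V) :=
      { carrier := {s | s ∈ R ∧ ∀ y ∈ spinorAnn ψ, cliffordAct s y ∈ R}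
        add_mem' := fun {a b} ha hb => ⟨R.add_mem ha.1 hb.1, fun y hy => by
          rw [cliffordAct_add_left]; exact R.add_mem (ha.2 y hy) (hb.2 y hy)⟩
        zero_mem' := ⟨R.zero_mem, fun y _ => by
          rw [cliffordAct_apply, map_zero, mul_zero, add_zero]; exact R.zero_mem⟩
        smul_mem' := fun c a ha => ⟨R.smul_mem c ha.1, fun y hy => by
          rw [cliffordAct_smul_left]; exact R.smul_mem c (ha.2 y hy)⟩ }
    have hRQ : R ≤ Q := by
      refine hmin Q ⟨hψR, fun y hy => ?_⟩ fun s hs x hx => ⟨hL s hs.1 x hx, fun y hy => ?_⟩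
      · rw [show cliffordAct ψ y = 0 from hy]; exact R.zero_mem
      · rw [eq_sub_of_add_eq (cliffordAct_cliffordAct_add s y x)]
        exact R.sub_mem (R.smul_mem _ hs.1) (hL _ (hs.2 y hy) x hx)
    exact fun s hs => (hRQ hs).2
  have hR : R = ⊤ := by
    refine eq_top_of_cliffordAct_mem (fun hbot => hψ.1 ?_) fun s hs z => ?_
    · rw [hbot] at hψR; exact (Submodule.mem_bot ℂ).1 hψR
    · obtain ⟨x, hx, y, hy, rfl⟩ := Submodule.mem_sup.1 (hsup ▸ Submodule.mem_top : z ∈ _)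
      rw [map_add]
      exact R.add_mem (hL s hs x hx) (hL' s hs y hy)
  let T : Submodule ℂ (Spinor V) :=
    LinearMap.ker (degreeComp (finrank ℝ V) ∘ₗ LinearMap.mulLeft ℂ (reverse φ))
  have hT (s : Spinor V) : s ∈ T ↔ mukai φ s = 0 := (mukai_eq_zero_iff φ s).symm
  refine hφ.1 (eq_zero_of_forall_mukai_eq_zero fun s => (hT s).1 ?_)
  refine hmin T ((hT ψ).2 h0) (fun s _ x hx => ?_) (hR ▸ Submodule.mem_top : s ∈ R)
  rw [hT, ← mukai_cliffordAct_eq_zero_iff, show cliffordAct φ x = 0 from hx, mukai_eq_zero_iff,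
    map_zero, zero_mul, map_zero]

theorem mukai_ne_zero_iff [FiniteDimensional ℝ V] {φ ψ : Spinor V}
    (hφ : IsPureSpinor φ) (hψ : IsPureSpinor ψ) :
    mukai φ ψ ≠ 0 ↔ spinorAnn φ ⊓ spinorAnn ψ = ⊥ := by
  refine ⟨fun h => ?_, mukai_ne_zero_of_inf_eq_bot hφ hψ⟩
  rw [Submodule.eq_bot_iff]
  intro x hx
  by_contra hx0
  exact h (mukai_eq_zero_of_mem_spinorAnn hx0 hx.1 hx.2)

end Mukai

/-! ### Complex conjugation of spinors -/

section Conj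

variable {V : Type*} [AddCommGroup V] [Module ℝ V]

theorem conjDual_conjDual (f : CxDual V) : conjDual (conjDual f) = f :=
  LinearMap.ext fun x => by simp

theorem conjDouble_conjDouble (x : Cx V × CxDual V) : conjDouble (conjDouble x) = x :=
  Prod.ext (conjV_conjV _) (conjDual_conjDual _)

theorem conjSpinor_conjSpinor (φ : Spinor V) : conjSpinor (conjSpinor φ) = φ := by
  induction φ using CliffordAlgebra.left_induction with
  | algebraMap r =>
    have h (c : ℂ) := conjSpinor_algebraMap (V := V) c
    exact (congrArg conjSpinor (h r)).trans ((h _).trans (by simp))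
  | add x y hx hy => rw [map_add, map_add, hx, hy]
  | ι_mul x m hx =>
    have h := conjSpinor_ι (V := V)
    simp only [ExteriorAlgebra.ι] at h
    rw [map_mul, map_mul, hx, h, h, conjDual_conjDual]

theorem conjSpinor_contr (v : Cx V) (φ : Spinor V) :
    conjSpinor (contr (Dual.eval ℂ (Cx V) v) φ) =
      contr (Dual.eval ℂ (Cx V) (conjV v)) (conjSpinor φ) := by
  induction φ using CliffordAlgebra.left_induction with
  | algebraMap r =>
    have h := conjSpinor_algebraMap (V := V) r
    simp only [contr, contractLeft_algebraMap, map_zero]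
    refine (Eq.trans (congrArg _ h) ?_).symm
    exact contractLeft_algebraMap (Q := 0) (d := Dual.eval ℂ (Cx V) (conjV v)) _
  | add x y hx hy => simp only [map_add, hx, hy]
  | ι_mul x m hx =>
    have h := conjSpinor_ι m
    have h1 := contr_ι_mul (Dual.eval ℂ (Cx V) v) m x
    have h2 := contr_ι_mul (Dual.eval ℂ (Cx V) (conjV v)) (conjDual m) (conjSpinor x)
    simp only [ExteriorAlgebra.ι] at h h1 h2
    rw [h1, map_sub, conjSpinor_smul, map_mul, map_mul, h, hx, h2]
    simp

theorem conjSpinor_cliffordAct (φ : Spinor V) (x : Cx V × CxDual V) :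
    conjSpinor (cliffordAct φ x) = cliffordAct (conjSpinor φ) (conjDouble x) := by
  rw [cliffordAct_apply, cliffordAct_apply, map_add, map_mul, conjSpinor_contr, conjSpinor_ι]
  rfl

theorem mem_conjSubspace {E : Submodule ℂ (Cx V × CxDual V)} {x : Cx V × CxDual V} :
    x ∈ conjSubspace E ↔ conjDouble x ∈ E := by
  refine ⟨?_, fun h => ⟨_, h, conjDouble_conjDouble x⟩⟩
  rintro ⟨y, hy, rfl⟩
  rwa [conjDouble_conjDouble]

theorem spinorAnn_conjSpinor (φ : Spinor V) :
    spinorAnn (conjSpinor φ) = conjSubspace (spinorAnn φ) := by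
  ext x
  rw [mem_conjSubspace, spinorAnn, spinorAnn, LinearMap.mem_ker, LinearMap.mem_ker]
  conv_lhs => rw [← conjDouble_conjDouble x, ← conjSpinor_cliffordAct]
  refine ⟨fun h => ?_, fun h => by rw [h, map_zero]⟩
  rw [← conjSpinor_conjSpinor (cliffordAct φ (conjDouble x)), h, map_zero]

theorem finrank_conjSubspace (E : Submodule ℂ (Cx V × CxDual V)) :
    finrank ℂ (conjSubspace E) = finrank ℂ E := by
  have hmem (x : conjSubspace E) : conjDouble (x : Cx V × CxDual V) ∈ E := mem_conjSubspace.1 x.2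
  let e : E ≃+ conjSubspace E :=
    { toFun := fun x => ⟨conjDouble (x : Cx V × CxDual V), x, x.2, rfl⟩
      invFun := fun x => ⟨conjDouble (x : Cx V × CxDual V), hmem x⟩
      left_inv := fun x => Subtype.ext (conjDouble_conjDouble _)
      right_inv := fun x => Subtype.ext (conjDouble_conjDouble _)
      map_add' := fun x y => Subtype.ext (map_add conjDouble _ _) }
  exact congrArg Cardinal.toNat (rank_eq_of_equiv_equiv (starRingEnd ℂ) e
    (starRingAut (R := ℂ)).bijective fun r m =>
      Subtype.ext (conjDouble.map_smulₛₗ r (m : Cx V × CxDual V))).symm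

theorem pairing_conjDouble (x y : Cx V × CxDual V) :
    pairing (conjDouble x) (conjDouble y) = starRingEnd ℂ (pairing x y) := by
  simp [pairing, conjDouble, Complex.conj_ofNat]

theorem IsMaxIsotropic.conjSubspace {E : Submodule ℂ (Cx V × CxDual V)} (hE : IsMaxIsotropic E) :
    IsMaxIsotropic (GCLin.conjSubspace E) where
  isotropic x hx y hy := by
    have h := hE.isotropic _ (mem_conjSubspace.1 hx) _ (mem_conjSubspace.1 hy)
    rw [pairing_conjDouble] at h
    exact (map_eq_zero _).1 h
  finrank_eq := (finrank_conjSubspace E).trans hE.finrank_eq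

theorem IsPureSpinor.conjSpinor {φ : Spinor V} (hφ : IsPureSpinor φ) :
    IsPureSpinor (GCLin.conjSpinor φ) := by
  refine ⟨fun h => hφ.1 ?_, spinorAnn_conjSpinor φ ▸ hφ.2.conjSubspace⟩
  rw [← conjSpinor_conjSpinor φ, h, map_zero]

theorem isGCSubspace_iff_mukai_ne_zero [FiniteDimensional ℝ V]
    {E : Submodule ℂ (Cx V × CxDual V)} {W : Submodule ℝ V} {φ : Spinor W}
    (hφ : IsRepresentative φ (induced E W)) :
    IsGCSubspace E W ↔ mukai φ (conjSpinor φ) ≠ 0 := by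
  rw [mukai_ne_zero_iff hφ.1 hφ.1.conjSpinor, spinorAnn_conjSpinor, hφ.2, IsGCSubspace]

end Conj

/-! ### Restriction and existence of two-forms -/

section Restriction

variable {K M N : Type*} [Field K] [AddCommGroup M] [Module K M] [AddCommGroup N] [Module K N]

theorem coe_exteriorPower_map (g : M →ₗ[K] N) (n : ℕ) (x : ⋀[K]^n M) :
    (exteriorPower.map n g x : ExteriorAlgebra K N) =
      ExteriorAlgebra.map g (x : ExteriorAlgebra K M) := by
  have h : (⋀[K]^n N).subtype ∘ₗ exteriorPower.map n g =
      (ExteriorAlgebra.map g).toLinearMap ∘ₗ (⋀[K]^n M).subtype := by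
    ext a; simp
  exact LinearMap.congr_fun h x

theorem contr_map (g : M →ₗ[K] N) (d : Dual K N) (x : ExteriorAlgebra K M) :
    contr d (ExteriorAlgebra.map g x) = ExteriorAlgebra.map g (contr (d ∘ₗ g) x) := by
  induction x using CliffordAlgebra.left_induction with
  | algebraMap r =>
    simp only [contr, contractLeft_algebraMap, map_zero]
    refine Eq.trans (congrArg _ (AlgHom.commutes _ r)) ?_
    exact contractLeft_algebraMap (Q := 0) (d := d) _
  | add x y hx hy => simp only [map_add, hx, hy]
  | ι_mul x m hx =>
    have h := ExteriorAlgebra.map_apply_ι g m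
    have h1 := contr_ι_mul (d ∘ₗ g) m x
    have h2 := contr_ι_mul d (g m) (ExteriorAlgebra.map g x)
    simp only [ExteriorAlgebra.ι] at h h1 h2
    rw [h1, map_mul, h, h2, map_sub, map_smul, map_mul, h, hx]
    rfl

theorem interior_map (g : M →ₗ[K] N) (u : ⋀[K]^2 M) (d : Dual K N) :
    interior (exteriorPower.map 2 g u) d = g (interior u (d ∘ₗ g)) := by
  apply (ExteriorAlgebra.ι_leftInverse (R := K) (M := N)).injective
  rw [ι_interior, coe_exteriorPower_map, contr_map, ← ι_interior, ExteriorAlgebra.map_apply_ι]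

/-- Every alternating bilinear form is the contraction with a two-form,
namely with `½ ∑ eⁱ ∧ B(e_i, ·)`. -/
theorem exists_interior_eq [CharZero K] [FiniteDimensional K M] (B : M →ₗ[K] Dual K M)
    (hB : ∀ v, B v v = 0) :
    ∃ u : ⋀[K]^2 (Dual K M), ∀ v, interior u (Dual.eval K M v) = B v := by
  have hskew (v w : M) : B v w = -B w v := by
    have h := hB (v + w)
    simp only [map_add, LinearMap.add_apply, hB, zero_add, add_zero] at h
    exact eq_neg_of_add_eq_zero_right h
  let b := Module.finBasis K M
  let x : ExteriorAlgebra K (Dual K M) := (2⁻¹ : K) • ∑ i,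
    ExteriorAlgebra.ι K (b.coord i) * ExteriorAlgebra.ι K (B (b i))
  have hx : x ∈ ⋀[K]^2 (Dual K M) := by
    refine Submodule.smul_mem _ _ (Submodule.sum_mem _ fun i _ => ?_)
    rw [ExteriorAlgebra.exteriorPower, pow_two]
    exact Submodule.mul_mem_mul (LinearMap.mem_range_self _ _) (LinearMap.mem_range_self _ _)
  refine ⟨⟨x, hx⟩, fun v => ?_⟩
  rw [interior_eq_of_coe_eq_sum ⟨x, hx⟩ (fun i => b.coord i) (fun i => B (b i)) 2⁻¹ rfl]
  ext w
  have h1 : ∑ i, b.coord i v * B (b i) w = B v w := by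
    conv_rhs => rw [← b.sum_repr v]
    simp [-Basis.sum_repr]
  have h2 : ∑ i, B (b i) v * b.coord i w = -B v w := by
    rw [← hskew w v]
    conv_rhs => rw [← b.sum_repr w]
    simp [-Basis.sum_repr, mul_comm]
  simp only [LinearMap.smul_apply, LinearMap.sum_apply, LinearMap.sub_apply, Dual.eval_apply,
    smul_eq_mul, Finset.sum_sub_distrib, h1, h2]
  field_simp
  ring

end Restriction

/-! ### Maximally isotropic subspaces and adapted bases -/

section Subspace

variable {V : Type*} [AddCommGroup V] [Module ℝ V]

/-- A maximally isotropic `E` is determined by `ρ(E)` and a two-form `u` such that `-ι_v u`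
extends the functional that `E` attaches to `v ∈ ρ(E)`. -/
theorem IsMaxIsotropic.exists_eq_shearSubspace [FiniteDimensional ℝ V]
    {E : Submodule ℂ (Cx V × CxDual V)} (hE : IsMaxIsotropic E) :
    ∃ u : ⋀[ℂ]^2 (CxDual V), shearSubspace u (rho E).dualAnnihilator = E := by
  have hiso {x y : Cx V × CxDual V} (hx : x ∈ E) (hy : y ∈ E) : x.2 y.1 + y.2 x.1 = 0 := by
    have h := hE.isotropic x hx y hy
    rw [pairing] at h
    simpa using h
  -- A linear section `t` of the projection of `E` to `ρ(E)`, extended to all of `V_ℂ`.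
  obtain ⟨t, ht⟩ : ∃ t : Cx V →ₗ[ℂ] E, ∀ v ∈ rho E, (t v : Cx V × CxDual V).1 = v := by
    let r : E →ₗ[ℂ] rho E := (LinearMap.fst ℂ (Cx V) (CxDual V)).submoduleMap E
    obtain ⟨s, hs⟩ := r.exists_rightInverse_of_surjective
      (LinearMap.range_eq_top.2 (LinearMap.submoduleMap_surjective _ E))
    obtain ⟨t, ht⟩ := s.exists_extend
    refine ⟨t, fun v hv => ?_⟩
    have h1 := LinearMap.congr_fun ht ⟨v, hv⟩
    have h2 := congrArg Subtype.val (LinearMap.congr_fun hs ⟨v, hv⟩)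
    simp only [LinearMap.comp_apply, Submodule.subtype_apply] at h1 h2
    rw [h1]
    exact h2
  let p : Cx V →ₗ[ℂ] Cx V := LinearMap.fst ℂ (Cx V) (CxDual V) ∘ₗ E.subtype ∘ₗ t
  let B : Cx V →ₗ[ℂ] CxDual V :=
    -(p.dualMap ∘ₗ LinearMap.snd ℂ (Cx V) (CxDual V) ∘ₗ E.subtype ∘ₗ t)
  have hB (v w : Cx V) : B v w = -(t v : Cx V × CxDual V).2 (t w : Cx V × CxDual V).1 := rfl
  obtain ⟨u, hu⟩ := exists_interior_eq B fun v => by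
    have h := hiso (t v).2 (t v).2
    rw [hB, neg_eq_zero]
    exact self_eq_neg.1 (eq_neg_of_add_eq_zero_left h)
  refine ⟨u, (Submodule.eq_of_le_of_finrank_eq (fun x hx => ?_) ?_).symm⟩
  · have hx1 : x.1 ∈ rho E := ⟨x, hx, rfl⟩
    rw [mem_shearSubspace]
    refine ⟨fun q hq => (Submodule.mem_dualAnnihilator q).1 hq _ hx1, ?_⟩
    rw [Submodule.mem_dualAnnihilator]
    intro w hw
    have h1 := hiso hx (t w).2
    have h2 := hiso (t x.1).2 (t w).2
    rw [ht w hw] at h1 h2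
    rw [ht x.1 hx1] at h2
    rw [hu, LinearMap.add_apply, hB, ht w hw]
    linear_combination h1 - h2
  · rw [hE.finrank_eq, finrank_shearSubspace]

theorem mem_dualAnnihilator_sup_iff (E : Submodule ℂ (Cx V × CxDual V)) (W : Submodule ℝ V)
    (g : CxDual V) :
    g ∈ (rho E ⊔ W.baseChange ℂ).dualAnnihilator ↔
      g ∈ (rho E).dualAnnihilator ∧ restr W g = 0 := by
  have hW : W.baseChange ℂ = LinearMap.range (incl W) := rfl
  rw [Submodule.dualAnnihilator_sup_eq, Submodule.mem_inf, hW,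
    ← LinearMap.ker_dualMap_eq_dualAnnihilator_range, LinearMap.mem_ker]
  rfl

/-- Restriction maps `Ann(ρ(E))` onto `Ann(ρ(E) ∩ W_ℂ)`. -/
theorem map_restr_dualAnnihilator (E : Submodule ℂ (Cx V × CxDual V)) (W : Submodule ℝ V) :
    (rho E).dualAnnihilator.map (restr W) = (rhoInf E W).dualAnnihilator := by
  apply le_antisymm
  · rintro _ ⟨g, hg, rfl⟩
    rw [Submodule.mem_dualAnnihilator]
    exact fun w hw => (Submodule.mem_dualAnnihilator g).1 hg _ hw
  · have hker : LinearMap.ker ((rho E).mkQ ∘ₗ incl W) = rhoInf E W := by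
      rw [LinearMap.ker_comp, Submodule.ker_mkQ]; rfl
    rw [← hker, ← LinearMap.range_dualMap_eq_dualAnnihilator_ker]
    rintro _ ⟨h, rfl⟩
    refine ⟨h ∘ₗ (rho E).mkQ, ?_, rfl⟩
    rw [SetLike.mem_coe, Submodule.mem_dualAnnihilator]
    intro v hv
    rw [LinearMap.comp_apply, Submodule.mkQ_apply, (Submodule.Quotient.mk_eq_zero _).2 hv, map_zero]

theorem exists_isBasisOf {M : Type*} [AddCommGroup M] [Module ℂ M] [FiniteDimensional ℂ M]
    (P : Submodule ℂ M) : ∃ (n : ℕ) (f : Fin n → M), IsBasisOf f P := by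
  refine ⟨_, fun i => (Module.finBasis ℂ P i : M), ?_, ?_⟩
  · exact (Module.finBasis ℂ P).linearIndependent.map' P.subtype P.ker_subtype
  · change Submodule.span ℂ (Set.range (P.subtype ∘ Module.finBasis ℂ P)) = P
    rw [Set.range_comp, ← Submodule.map_span, Basis.span_eq, Submodule.map_top,
      Submodule.range_subtype]

/-- There is a basis of `Ann(ρ(E))` adapted to `E` and `W`: lift a basis of `Ann(ρ(E) ∩ W_ℂ)` and
append a basis of `Ann(ρ(E) + W_ℂ)`, the kernel of the restriction to `W_ℂ`. -/
theorem exists_isAdapted [FiniteDimensional ℝ V] (E : Submodule ℂ (Cx V × CxDual V))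
    (W : Submodule ℝ V) :
    ∃ (k l : ℕ) (hl : l ≤ k) (f : Fin k → CxDual V),
      IsBasisOf f (rho E).dualAnnihilator ∧ IsAdapted E W hl f := by
  obtain ⟨l, g, hg⟩ := exists_isBasisOf (rhoInf E W).dualAnnihilator
  obtain ⟨q, f₂, hf₂⟩ := exists_isBasisOf (rho E ⊔ W.baseChange ℂ).dualAnnihilator
  have hlift (i : Fin l) : ∃ h ∈ (rho E).dualAnnihilator, restr W h = g i := by
    have : g i ∈ (rho E).dualAnnihilator.map (restr W) := by
      rw [map_restr_dualAnnihilator, ← hg.2]; exact Submodule.subset_span ⟨i, rfl⟩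
    exact this
  choose f₁ hf₁ hf₁g using hlift
  have hcomp : restr W ∘ f₁ = g := funext hf₁g
  have hf₂mem (i : Fin q) : f₂ i ∈ (rho E).dualAnnihilator ∧ restr W (f₂ i) = 0 := by
    rw [← mem_dualAnnihilator_sup_iff, ← hf₂.2]; exact Submodule.subset_span ⟨i, rfl⟩
  have hli : LinearIndependent ℂ (restr W ∘ f₁) := hcomp ▸ hg.1
  have happ : Fin.append f₁ f₂ ∘ finSumFinEquiv = Sum.elim f₁ f₂ := by
    funext i; rcases i with i | j <;> simp
  refine ⟨l + q, l, Nat.le_add_right l q, Fin.append f₁ f₂, ⟨?_, ?_⟩, ?_, ?_⟩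
  · rw [← linearIndependent_equiv finSumFinEquiv, happ]
    refine (hli.of_comp).sum_type hf₂.1 ?_
    refine (Submodule.range_ker_disjoint hli).mono_right (Submodule.span_le.2 ?_)
    rintro _ ⟨j, rfl⟩
    exact (hf₂mem j).2
  · rw [← finSumFinEquiv.surjective.range_comp, happ, Set.Sum.elim_range, Submodule.span_union]
    apply le_antisymm
    · refine sup_le (Submodule.span_le.2 ?_) (Submodule.span_le.2 ?_)
      · rintro _ ⟨i, rfl⟩; exact hf₁ i
      · rintro _ ⟨j, rfl⟩; exact (hf₂mem j).1
    · intro p hp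
      have hp' : restr W p ∈ (Submodule.span ℂ (Set.range f₁)).map (restr W) := by
        rw [Submodule.map_span, ← Set.range_comp, hcomp, hg.2, ← map_restr_dualAnnihilator]
        exact ⟨p, hp, rfl⟩
      obtain ⟨q', hq', hpq⟩ := hp'
      have hq'P : q' ∈ (rho E).dualAnnihilator :=
        Submodule.span_le.2 (by rintro _ ⟨i, rfl⟩; exact hf₁ i) hq'
      have hdiff : p - q' ∈ Submodule.span ℂ (Set.range f₂) := by
        rw [hf₂.2, mem_dualAnnihilator_sup_iff, map_sub, hpq, sub_self]
        exact ⟨Submodule.sub_mem _ hp hq'P, rfl⟩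
      exact Submodule.mem_sup.2 ⟨q', hq', p - q', hdiff, add_sub_cancel _ _⟩
  · convert hg using 1
    funext i
    rw [← hf₁g i]
    exact congrArg _ (Fin.append_left f₁ f₂ i)
  · let e : Fin q ≃ {i : Fin (l + q) // l ≤ (i : ℕ)} := Equiv.ofBijective
      (fun j => ⟨Fin.natAdd l j, by simp⟩) ⟨fun a b h => by simpa using h, fun i => by
        refine ⟨⟨(i : ℕ) - l, by omega⟩, Subtype.ext (Fin.ext ?_)⟩
        have := i.2
        simp only [Fin.natAdd_mk]
        omega⟩
    have he : (fun i : {i : Fin (l + q) // l ≤ (i : ℕ)} => Fin.append f₁ f₂ i) ∘ e = f₂ :=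
      funext fun j => Fin.append_right f₁ f₂ j
    refine ⟨(linearIndependent_equiv' e he).1 hf₂.1, ?_⟩
    rw [← hf₂.2, ← e.surjective.range_comp, he]

/-- Passing to the subspace induced on `W` restricts the two-form and the space of linear forms,
provided that the `f i` with `l ≤ i` vanish on `W_ℂ`. -/
theorem induced_shearSubspace (u : ⋀[ℂ]^2 (CxDual V)) (W : Submodule ℝ V) {k l : ℕ} (hl : l ≤ k)
    (f : Fin k → CxDual V) (hf : ∀ i : Fin k, l ≤ (i : ℕ) → restr W (f i) = 0) :
    induced (shearSubspace u (Submodule.span ℂ (Set.range f))) W =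
      shearSubspace (restrTwo W u)
        (Submodule.span ℂ (Set.range fun i : Fin l => restr W (f (Fin.castLE hl i)))) := by
  set P := Submodule.span ℂ (Set.range f)
  set P' := Submodule.span ℂ (Set.range fun i : Fin l => restr W (f (Fin.castLE hl i)))
  have hP : P.map (restr W) = P' := by
    rw [Submodule.map_span]
    apply le_antisymm <;> rw [Submodule.span_le]
    · rintro _ ⟨_, ⟨i, rfl⟩, rfl⟩
      by_cases hi : (i : ℕ) < l
      · exact Submodule.subset_span ⟨⟨i, hi⟩, rfl⟩
      · rw [hf i (not_lt.1 hi)]; exact zero_mem _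
    · rintro _ ⟨i, rfl⟩
      exact Submodule.subset_span ⟨_, ⟨_, rfl⟩, rfl⟩
  have hint (w : Cx W) : interior (restrTwo W u) (Dual.eval ℂ (Cx W) w) =
      restr W (interior u (Dual.eval ℂ (Cx V) (incl W w))) :=
    interior_map (restr W) u _
  ext ⟨w, g⟩
  rw [mem_induced, mem_shearSubspace, hint, ← hP]
  constructor
  · rintro ⟨h, hh, rfl⟩
    rw [mem_shearSubspace] at hh
    refine ⟨?_, ?_⟩
    · rintro _ ⟨q, hq, rfl⟩; exact hh.1 q hq
    · rw [← map_add]; exact ⟨_, hh.2, rfl⟩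
  · rintro ⟨h1, q, hq, hqg⟩
    refine ⟨q - interior u (Dual.eval ℂ (Cx V) (incl W w)), ?_, ?_⟩
    · rw [mem_shearSubspace]
      refine ⟨fun p hp => h1 _ ⟨p, hp, rfl⟩, ?_⟩
      rwa [sub_add_cancel]
    · rw [map_sub, hqg, add_sub_cancel_right]

/-- Adaptedness makes `f i` vanish on `W_ℂ` for `l ≤ i` and keeps the restrictions of the other
`f i` independent. -/
theorem isRepresentative_restrict [FiniteDimensional ℝ V] {E : Submodule ℂ (Cx V × CxDual V)}
    {W : Submodule ℝ V} {k l : ℕ} {hl : l ≤ k} {u : ⋀[ℂ]^2 (CxDual V)} {f : Fin k → CxDual V}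
    (hrep : IsRepresentative (spinorOf u f) E) (hf : IsAdapted E W hl f) :
    IsRepresentative (spinorOf (restrTwo W u) fun i : Fin l => restr W (f (Fin.castLE hl i)))
      (induced E W) := by
  refine ⟨isPureSpinor_spinorOf _ hf.1.1, ?_⟩
  rw [spinorAnn_spinorOf _ hf.1.1, ← hrep.2,
    spinorAnn_spinorOf u (linearIndependent_of_spinorOf_ne_zero hrep.1.1)]
  refine (induced_shearSubspace u W hl f fun i hi => ?_).symm
  refine ((mem_dualAnnihilator_sup_iff E W (f i)).1 ?_).2
  rw [← hf.2.2]
  exact Submodule.subset_span ⟨⟨i, hi⟩, rfl⟩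

end Subspace

end GCLin

theorem proposition3p1 {V : Type*} [AddCommGroup V] [Module ℝ V] [FiniteDimensional ℝ V]
    (E : Submodule ℂ (GCLin.Cx V × GCLin.CxDual V)) (hE : GCLin.IsGCStructure E)
    (W : Submodule ℝ V) :
    (∃ (k l : ℕ) (hl : l ≤ k) (u : ⋀[ℂ]^2 (GCLin.CxDual V)) (f : Fin k → GCLin.CxDual V),
      GCLin.IsRepresentative (GCLin.spinorOf u f) E ∧ GCLin.IsAdapted E W hl f) ∧
    (∀ (k l : ℕ) (hl : l ≤ k) (u : ⋀[ℂ]^2 (GCLin.CxDual V)) (f : Fin k → GCLin.CxDual V),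
      GCLin.IsRepresentative (GCLin.spinorOf u f) E → GCLin.IsAdapted E W hl f →
      ∀ φW : GCLin.Spinor W,
        φW = GCLin.spinorOf (GCLin.restrTwo W u)
          (fun i : Fin l => GCLin.restr W (f (Fin.castLE hl i))) →
        GCLin.IsRepresentative φW (GCLin.induced E W) ∧
        (GCLin.IsGCSubspace E W ↔ GCLin.mukai φW (GCLin.conjSpinor φW) ≠ 0)) := by
  constructor
  · obtain ⟨u, hu⟩ := hE.maxIsotropic.exists_eq_shearSubspace
    obtain ⟨k, l, hl, f, hf, hfW⟩ := GCLin.exists_isAdapted E W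
    refine ⟨k, l, hl, u, f, ⟨GCLin.isPureSpinor_spinorOf u hf.1, ?_⟩, hfW⟩
    rw [GCLin.spinorAnn_spinorOf u hf.1, hf.2, hu]
  · rintro k l hl u f hrep hf _ rfl
    have h := GCLin.isRepresentative_restrict hrep hf
    exact ⟨h, GCLin.isGCSubspace_iff_mukai_ne_zero h⟩
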